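/- Let $\mathbb X=\{(a,b):a>0,\ b\in\mathbb R\}$ be the $ax+b$ group, with product $(a,b)(c,d)=(ac,ad+b)$, and let $\mu(da\,db)=a^{-2}\,da\,db$. Then $\mu$ is a left Haar measure on $\mathbb X$ that is not right-invariant, i.e. $\mathbb X$ is not unimodular. Let $\lambda,\delta>0$ satisfy $2\delta\lambda<1$, and let $\mathfrak m$ be a homogeneous Poisson point process on $\mathbb X$ of intensity $\lambda$, i.e. with intensity measure $\lambda\mu$; identify $\mathfrak m$ with its set of points. For $X=(a,b)\in\mathbb X$ put $S(X)=[a,\infty)\times[b-\delta a,\,b+\delta a]$. The strip point-shift $H$ sends $X\in\mathfrak m$ to the point $H(X)$ of $\mathfrak m\cap S(X)$ with the largest first coordinate (ties being resolved lexicographically). Let $G$ be the graph on $\mathfrak m$ with an edge from each $X$ to $H(X)$; components are the undirected connected components of $G$, and the foil of $X$ is $\{Y\in\mathfrak m:\exists n\ge 0,\ H^n(X)=H^n(Y)\}$. A point of $\mathfrak m$ is primeval if it lies in $H^n(\mathfrak m)$ for every $n\ge 0$. Almost surely, the following hold. 1. For every $X\in\mathfrak m$, $\mathfrak m(S(X))<\infty$,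 and $H(X)$ is the unique point of $\mathfrak m\cap S(X)$ with the largest first coordinate, so no ties occur. 2. For every $X\in\mathfrak m$ the sequence $(H^n(X))_{n\ge 0}$ is eventually constant. 3. Every fixed point of $H$ in $\mathfrak m$ is the image under $H$ of infinitely many points of $\mathfrak m$. 4. The foil of each point equals its component. Each component contains exactly one fixed point of $H$, and the component of a fixed point $Y$ is $\{X\in\mathfrak m: \exists n\ge 0,\ H^n(X)=Y\}$. 5. Fixed points of $H$ exist in $\mathfrak m$, and every fixed point is primeval. 6. Every component is infinite and all of its foils are infinite (type $\mathcal I/\mathcal I$); nevertheless every component contains a cycle of $G$ (a fixed point of $H$) and a primeval point. Consequently, almost surely no component satisfies the conclusion of the cardinality classification valid for point-shifts on unimodular groups, namely that a component $C$ belongs to one of the following three classes: - $\mathcal F/\mathcal F$: $C$ is finite, it has a unique cycle, whose length is the number of foils of $C$, and the primeval points of $C$ are the vertices of this cycle; - $\mathcal I/\mathcal F$: $C$ is infinite and acyclic, all its foils are finite, for each foil $L$ of $C$ there is $Y\in\mathfrak m$ with $H(Y)\in L$, and the primeval points of $C$ form a bi-infinite path $(X_n)_{n\in\mathbb Z}$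 with $H(X_n)=X_{n+1}$, unique up to shifting the index; - $\mathcal I/\mathcal I$: $C$ is infinite and acyclic, all its foils are infinite, and $C$ contains no primeval point. -/

import Mathlib

open MeasureTheory ProbabilityTheory
open scoped ENNReal

/-! ### The `ax+b` group -/

/-- The `ax+b` group: the matrices `(a b; 0 1)` with `a > 0` and `b` real, identified with the
points `(a, b)` of the open right half-plane (with the topology of the plane). -/
def AxB : Type := {p : ℝ × ℝ // 0 < p.1}

namespace AxB

instance : TopologicalSpace AxB := inferInstanceAs (TopologicalSpace {p : ℝ × ℝ // 0 < p.1})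

instance : MeasurableSpace AxB := inferInstanceAs (MeasurableSpace {p : ℝ × ℝ // 0 < p.1})

instance : BorelSpace AxB := inferInstanceAs (BorelSpace {p : ℝ × ℝ // 0 < p.1})

/-- The diagonal coordinate `a > 0` (the first, i.e. horizontal, coordinate). -/
def a (x : AxB) : ℝ := x.1.1

/-- The off-diagonal coordinate `b` (the second, i.e. vertical, coordinate). -/
def b (x : AxB) : ℝ := x.1.2

theorem a_pos (x : AxB) : 0 < x.a := x.2

@[ext] theorem ext {x y : AxB} (ha : x.a = y.a) (hb : x.b = y.b) : x = y :=
  Subtype.ext (Prod.ext ha hb)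

/-- Matrix multiplication, `(a, b) (c, d) = (a c, a d + b)`. -/
instance : Mul AxB := ⟨fun x y => ⟨(x.a * y.a, x.a * y.b + x.b), mul_pos x.a_pos y.a_pos⟩⟩

/-- The identity matrix is the point `(1, 0)`. -/
instance : One AxB := ⟨⟨(1, 0), one_pos⟩⟩

/-- Matrix inverse, `(a, b)⁻¹ = (1 / a, - b / a)`. -/
noncomputable instance : Inv AxB := ⟨fun x => ⟨(1 / x.a, -x.b / x.a), one_div_pos.2 x.a_pos⟩⟩

@[simp] theorem mul_a (x y : AxB) : (x * y).a = x.a * y.a := rfl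
@[simp] theorem mul_b (x y : AxB) : (x * y).b = x.a * y.b + x.b := rfl
@[simp] theorem one_a : (1 : AxB).a = 1 := rfl
@[simp] theorem one_b : (1 : AxB).b = 0 := rfl
@[simp] theorem inv_a (x : AxB) : (x⁻¹).a = 1 / x.a := rfl
@[simp] theorem inv_b (x : AxB) : (x⁻¹).b = -x.b / x.a := rfl

noncomputable instance : Group AxB :=
  Group.ofLeftAxioms
    (fun x y z => by ext <;> simp <;> ring)
    (fun x => by ext <;> simp)
    (fun x => by
      have h := x.a_pos.ne'
      ext
      · simp [h]
      · simp only [mul_b, inv_a, inv_b, one_b]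
        ring)

/-- The measure `a⁻² da db` on the `ax+b` group. -/
noncomputable def haar : Measure AxB :=
  Measure.comap (Subtype.val : {p : ℝ × ℝ // 0 < p.1} → ℝ × ℝ)
    ((volume : Measure (ℝ × ℝ)).withDensity fun p => ENNReal.ofReal (1 / p.1 ^ 2))

/-- The strip `S(a, b) = [a, ∞) × [b - δ a, b + δ a]`. -/
def strip (δ : ℝ) (x : AxB) : Set AxB :=
  {y | x.a ≤ y.a ∧ x.b - δ * x.a ≤ y.b ∧ y.b ≤ x.b + δ * x.a}

/-- `y` is the right-most point of the configuration `N` in the strip at `x`, ties being resolved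
by the lexicographic order on coordinates. -/
def IsRightmost (δ : ℝ) (N : Set AxB) (x y : AxB) : Prop :=
  y ∈ N ∩ strip δ x ∧ ∀ z ∈ N ∩ strip δ x, z.a < y.a ∨ (z.a = y.a ∧ z.b ≤ y.b)

open Classical in
/-- The strip point-shift of the configuration `N`: a point `x` of `N` is sent to the right-most
point of `N` in the strip at `x`. It is the identity off `N` (and, by convention, at points whose
strip has no right-most point). -/
noncomputable def stripShift (δ : ℝ) (N : Set AxB) (x : AxB) : AxB :=
  if h : x ∈ N ∧ ∃ y, IsRightmost δ N x y then h.2.choose else x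

end AxB

/-! ### Point processes -/

section PointProcess

variable {Ω α : Type*} [MeasurableSpace Ω] [TopologicalSpace α] [MeasurableSpace α]

/-- A point process: a random element (for the `σ`-algebra generated by the evaluations
`μ ↦ μ B`) of the space of locally finite counting measures. -/
structure IsPointProcess (m : Ω → Measure α) : Prop where
  measurable : Measurable m
  locallyFinite : ∀ ω, IsLocallyFiniteMeasure (m ω)
  counting : ∀ ω, ∃ (ι : Type) (_ : Countable ι) (x : ι → α),
    m ω = Measure.sum fun i => Measure.dirac (x i)

/-- A Poisson point process with intensity measure `Λ`. -/
structure IsPoissonProcess (P : Measure Ω) (m : Ω → Measure α) (Λ : Measure α) : Prop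
    extends IsPointProcess m where
  poisson : ∀ B : Set α, MeasurableSet B → Λ B ≠ ∞ →
    P.map (fun ω => m ω B) = (poissonMeasure (Λ B).toNNReal).map (fun k : ℕ => (k : ℝ≥0∞))
  indep : ∀ (n : ℕ) (B : Fin n → Set α), (∀ i, MeasurableSet (B i)) →
    Pairwise (fun i j => Disjoint (B i) (B j)) → iIndepFun (fun i ω => m ω (B i)) P

/-- The set of points (atoms) of a counting measure. -/
def pointsOf (μ : Measure α) : Set α := {x | μ {x} ≠ 0}

end PointProcess

/-! ### The graph of a point-shift -/

namespace PointShift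

variable {α : Type*}

/-- Points fixed by `H`. -/
def fixedPts (N : Set α) (H : α → α) : Set α := {x ∈ N | H x = x}

/-- The primeval points: those in the image `H^n(N)` for every `n`. -/
def primeval (N : Set α) (H : α → α) : Set α := ⋂ n : ℕ, H^[n] '' N

/-- The undirected connected component of `x` in the graph with vertex set `N` and an edge from
each `u` to `H u`. -/
def component (N : Set α) (H : α → α) (x : α) : Set α :=
  {y ∈ N | Relation.EqvGen (fun u v => u ∈ N ∧ v ∈ N ∧ H u = v) x y}

/-- The set of connected components. -/
def components (N : Set α) (H : α → α) : Set (Set α) := component N H '' N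

/-- The foil of `x`: the points having a common `n`-th iterate with `x`, for some `n`. -/
def foil (N : Set α) (H : α → α) (x : α) : Set α := {y ∈ N | ∃ n : ℕ, H^[n] x = H^[n] y}

/-- The foils of the points of `C`. -/
def foilsIn (N : Set α) (H : α → α) (C : Set α) : Set (Set α) := foil N H '' C

/-- `K` is the vertex set of a directed cycle of length `n ≥ 1`. -/
def IsCycle (H : α → α) (n : ℕ) (K : Set α) : Prop :=
  0 < n ∧ ∃ x, Function.minimalPeriod H x = n ∧ K = Set.range fun i : ℕ => H^[i] x

/-- `C` contains no directed cycle. -/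
def Acyclic (H : α → α) (C : Set α) : Prop := ∀ n K, IsCycle H n K → ¬ K ⊆ C

/-- Type `I/I`: `C` is infinite and all its foils are infinite. -/
def TypeII (N : Set α) (H : α → α) (C : Set α) : Prop :=
  C.Infinite ∧ ∀ L ∈ foilsIn N H C, L.Infinite

/-- Type `I/F`: `C` is infinite and all its foils are finite. -/
def TypeIF (N : Set α) (H : α → α) (C : Set α) : Prop :=
  C.Infinite ∧ ∀ L ∈ foilsIn N H C, L.Finite

/-- A bi-infinite path in `C`. -/
def IsBiInfinitePath (H : α → α) (C : Set α) (p : ℤ → α) : Prop :=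
  ∀ n, p n ∈ C ∧ H (p n) = p (n + 1)

/-- The trichotomy asserted for a component `C` by the cardinality classification:
* type `F/F`: `C` is finite, has a unique cycle, whose length is the number of foils of `C`, and
  the primeval points of `C` are those of this cycle;
* type `I/F`: `C` is acyclic, each of its foils has a junior foil, and the primeval points of `C`
  form the unique bi-infinite path of `C`;
* type `I/I`: `C` is acyclic and has no primeval points. -/
def Classified (N : Set α) (H : α → α) (C : Set α) : Prop :=
  (C.Finite ∧ ∃ K ⊆ C, IsCycle H (foilsIn N H C).ncard K ∧
      (∀ n K', IsCycle H n K' → K' ⊆ C → K' = K) ∧ primeval N H ∩ C = K) ∨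
  (TypeIF N H C ∧ Acyclic H C ∧ (∀ L ∈ foilsIn N H C, ∃ y ∈ N, H y ∈ L) ∧
      ∃ p : ℤ → α, IsBiInfinitePath H C p ∧ primeval N H ∩ C = Set.range p ∧
        ∀ q : ℤ → α, IsBiInfinitePath H C q → ∃ k : ℤ, ∀ n, q n = p (n + k)) ∨
  (TypeII N H C ∧ Acyclic H C ∧ primeval N H ∩ C = ∅)

end PointShift

/-!
Almost surely no two points have the same first coordinate, since the intensity of the first
coordinates is absolutely continuous.

The strip at a point `(a, b)` has measure `2 δ` whatever `a` and `b`, so a point of the process has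
on average at most `2 δ lam < 1` possible images further to the right, and the expected number of
strictly increasing `n`-step paths of moves starting in a set of finite measure decays like
`(2 δ lam) ^ n`. No orbit is therefore infinite. To avoid the multivariate Mecke formula, the paths
are counted on a grid whose mesh tends to `0`: the occupied squares of a path are distinct because
its columns increase, hence independent.

The cone `{x | |x.b - y.b| ≤ δ x.a}` below the scale `x.a < ε` has infinite measure, since its
dyadic pieces all have the same measure. So it contains points of the process arbitrarily close to
the boundary `a = 0`, and these are all mapped to `y` when `y` is a fixed point.
-/

namespace AxB

open Set Filter Topology

theorem continuous_a : Continuous a := continuous_fst.comp continuous_subtype_val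

theorem continuous_b : Continuous b := continuous_snd.comp continuous_subtype_val

theorem measurable_a : Measurable a := continuous_a.measurable

theorem measurable_b : Measurable b := continuous_b.measurable

instance : SecondCountableTopology AxB :=
  inferInstanceAs (SecondCountableTopology {p : ℝ × ℝ // 0 < p.1})

instance : MeasurableSingletonClass AxB :=
  inferInstanceAs (MeasurableSingletonClass {p : ℝ × ℝ // 0 < p.1})

instance : ContinuousMul AxB where
  continuous_mul := by
    have := continuous_a
    have := continuous_b
    exact Continuous.subtype_mk
      (f := fun x : AxB × AxB => (x.1.a * x.2.a, x.1.a * x.2.b + x.1.b)) (by fun_prop) _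

/-- The points with first coordinate in `I` and second coordinate in `J`. -/
def box (I J : Set ℝ) : Set AxB := {x | x.a ∈ I ∧ x.b ∈ J}

theorem isOpen_box {I J : Set ℝ} (hI : IsOpen I) (hJ : IsOpen J) : IsOpen (box I J) :=
  (hI.preimage continuous_a).inter (hJ.preimage continuous_b)

theorem measurableSet_box {I J : Set ℝ} (hI : MeasurableSet I) (hJ : MeasurableSet J) :
    MeasurableSet (box I J) :=
  (measurable_a hI).inter (measurable_b hJ)

theorem box_subset_box {I I' J J' : Set ℝ} (hI : I ⊆ I') (hJ : J ⊆ J') : box I J ⊆ box I' J' :=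
  fun _ h => ⟨hI h.1, hJ h.2⟩

theorem strip_eq_box (δ : ℝ) (x : AxB) :
    strip δ x = box (Ici x.a) (Icc (x.b - δ * x.a) (x.b + δ * x.a)) := rfl

/-- The measure `a⁻² da` on the whole line; its product with Lebesgue measure, restricted to the
open right half-plane, is `haar`. -/
noncomputable def invSqMeasure : Measure ℝ :=
  volume.withDensity fun a => ENNReal.ofReal (1 / a ^ 2)

instance : SFinite invSqMeasure := by
  unfold invSqMeasure
  infer_instance

theorem invSqMeasure_apply {s : Set ℝ} (hs : MeasurableSet s) :
    invSqMeasure s = ∫⁻ a in s, ENNReal.ofReal (1 / a ^ 2) :=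
  withDensity_apply _ hs

theorem invSqMeasure_Ici {t : ℝ} (ht : 0 < t) :
    invSqMeasure (Ici t) = ENNReal.ofReal (1 / t) := by
  have hpow : EqOn (fun x : ℝ => x ^ (-2 : ℝ)) (fun x => 1 / x ^ 2) (Ioi t) := fun x hx => by
    simp only [Real.rpow_neg (ht.trans hx).le, Real.rpow_ofNat, one_div]
  have hint : IntegrableOn (fun x : ℝ => 1 / x ^ 2) (Ioi t) :=
    (integrableOn_Ioi_rpow_of_lt (by norm_num) ht).congr_fun hpow measurableSet_Ioi
  rw [invSqMeasure_apply measurableSet_Ici, setLIntegral_congr Ioi_ae_eq_Ici.symm,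
    ← ofReal_integral_eq_lintegral_ofReal hint (ae_of_all _ fun x => by positivity),
    ← setIntegral_congr_fun measurableSet_Ioi hpow, integral_Ioi_rpow_of_lt (by norm_num) ht]
  norm_num [Real.rpow_neg_one]

theorem invSqMeasure_Ico {s t : ℝ} (hs : 0 < s) (hst : s ≤ t) :
    invSqMeasure (Ico s t) = ENNReal.ofReal (1 / s - 1 / t) := by
  have ht := hs.trans_le hst
  rw [← Ici_sdiff_Ici, measure_sdiff (Ici_subset_Ici.2 hst)
    measurableSet_Ici.nullMeasurableSet (by simp [invSqMeasure_Ici ht]),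
    invSqMeasure_Ici hs, invSqMeasure_Ici ht, ENNReal.ofReal_sub _ (by positivity)]

theorem map_mul_invSqMeasure {c : ℝ} (hc : 0 < c) :
    invSqMeasure.map (c * ·) = ENNReal.ofReal c • invSqMeasure := by
  have hmul : Measurable (c * ·) := measurable_const_mul c
  have hscale (x : ℝ) : ENNReal.ofReal (1 / x ^ 2) =
      ENNReal.ofReal (c ^ 2) * ENNReal.ofReal (1 / (c * x) ^ 2) := by
    rw [← ENNReal.ofReal_mul (by positivity)]
    congr 1
    field_simp
  ext s hs
  calc invSqMeasure.map (c * ·) s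
      = ENNReal.ofReal (c ^ 2) * ∫⁻ x in (c * ·) ⁻¹' s, ENNReal.ofReal (1 / (c * x) ^ 2) := by
        rw [Measure.map_apply hmul hs, invSqMeasure_apply (hmul hs),
          ← lintegral_const_mul' _ _ ENNReal.ofReal_ne_top]
        simp_rw [← hscale]
    _ = ENNReal.ofReal (c ^ 2) * (ENNReal.ofReal c⁻¹ * invSqMeasure s) := by
        rw [← setLIntegral_map hs (f := fun y => ENNReal.ofReal (1 / y ^ 2)) (by fun_prop) hmul,
          Real.map_volume_mul_left hc.ne', abs_of_pos (inv_pos.2 hc), Measure.restrict_smul,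
          lintegral_smul_measure, invSqMeasure_apply hs, smul_eq_mul]
    _ = (ENNReal.ofReal c • invSqMeasure) s := by
        rw [← mul_assoc, ← ENNReal.ofReal_mul (by positivity), Measure.smul_apply, smul_eq_mul]
        congr 2
        field_simp

/-- The embedding of the group in the plane, as the open right half-plane. -/
def coords (x : AxB) : ℝ × ℝ := (x.a, x.b)

theorem isOpenEmbedding_coords : IsOpenEmbedding coords :=
  (isOpen_lt continuous_const continuous_fst).isOpenEmbedding_subtypeVal

theorem measurableEmbedding_coords : MeasurableEmbedding coords :=
  isOpenEmbedding_coords.measurableEmbedding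

theorem haar_apply (s : Set AxB) :
    haar s = volume.withDensity (fun p : ℝ × ℝ => ENNReal.ofReal (1 / p.1 ^ 2)) (coords '' s) :=
  measurableEmbedding_coords.comap_apply _ _

theorem haar_apply_prod (s : Set AxB) : haar s = (invSqMeasure.prod volume) (coords '' s) := by
  rw [haar_apply, invSqMeasure, prod_withDensity_left (by fun_prop), Measure.volume_eq_prod]

theorem haar_box (I J : Set ℝ) : haar (box I J) = invSqMeasure (I ∩ Ioi 0) * volume J := by
  have himage : coords '' box I J = (I ∩ Ioi 0) ×ˢ J := by
    ext ⟨p, q⟩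
    constructor
    · rintro ⟨x, ⟨ha, hb⟩, hx⟩
      cases hx
      exact ⟨⟨ha, x.a_pos⟩, hb⟩
    · rintro ⟨⟨ha, hpos⟩, hb⟩
      exact ⟨⟨(p, q), hpos⟩, ⟨ha, hb⟩, rfl⟩
  rw [haar_apply_prod, himage, Measure.prod_prod]

theorem haar_box_Ici_Icc {t : ℝ} (ht : 0 < t) (u v : ℝ) :
    haar (box (Ici t) (Icc u v)) = ENNReal.ofReal ((v - u) / t) := by
  rw [haar_box, inter_eq_left.2 (Ici_subset_Ioi.2 ht), invSqMeasure_Ici ht, Real.volume_Icc,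
    ← ENNReal.ofReal_mul (by positivity), one_div_mul_eq_div]

theorem haar_box_Ico_Icc {s t : ℝ} (hs : 0 < s) (hst : s ≤ t) (u v : ℝ) :
    haar (box (Ico s t) (Icc u v)) = ENNReal.ofReal ((1 / s - 1 / t) * (v - u)) := by
  rw [haar_box, inter_eq_left.2 (Ico_subset_Ici_self.trans (Ici_subset_Ioi.2 hs)),
    invSqMeasure_Ico hs hst, Real.volume_Icc,
    ← ENNReal.ofReal_mul (sub_nonneg.2 (one_div_le_one_div_of_le hs hst))]

theorem map_a_haar_absolutelyContinuous : haar.map a ≪ volume := by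
  refine Measure.AbsolutelyContinuous.mk fun s hs h0 => ?_
  have hpre : a ⁻¹' s = box s univ := by ext x; simp [box]
  have : invSqMeasure s = 0 := withDensity_absolutelyContinuous _ _ h0
  rw [Measure.map_apply measurable_a hs, hpre, haar_box,
    measure_mono_null inter_subset_left this, zero_mul]

theorem haar_univ : haar univ = ∞ := by
  have huniv : (univ : Set AxB) = box univ univ := by ext x; simp [box]
  have hpos : invSqMeasure (Ioi 0) ≠ 0 := fun h => by
    have := measure_mono_null (Ici_subset_Ioi.2 one_pos) h
    simp [invSqMeasure_Ici one_pos] at this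
  rw [huniv, haar_box, univ_inter, Real.volume_univ, ENNReal.mul_top hpos]

instance : IsLocallyFiniteMeasure haar := ⟨fun x => by
  refine ⟨box (Ioi (x.a / 2)) (Ioo (x.b - 1) (x.b + 1)),
    (isOpen_box isOpen_Ioi isOpen_Ioo).mem_nhds
      ⟨half_lt_self x.a_pos, by simp, by simp⟩, ?_⟩
  refine (measure_mono (box_subset_box Ioi_subset_Ici_self Ioo_subset_Icc_self)).trans_lt ?_
  rw [haar_box_Ici_Icc (half_pos x.a_pos)]
  exact ENNReal.ofReal_lt_top⟩

theorem map_prodMap_mul_add (c d : ℝ) (hc : 0 < c) :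
    (invSqMeasure.prod volume).map (Prod.map (c * ·) (c * · + d)) = invSqMeasure.prod volume := by
  have hvol : (volume : Measure ℝ).map (c * · + d) = ENNReal.ofReal c⁻¹ • volume := by
    have hcomp : (c * · + d) = (· + d) ∘ (c * ·) := rfl
    rw [hcomp, ← Measure.map_map (by fun_prop) (by fun_prop), Real.map_volume_mul_left hc.ne',
      Measure.map_smul, map_add_right_eq_self, abs_of_pos (inv_pos.2 hc)]
  rw [← Measure.map_prod_map _ _ (by fun_prop) (by fun_prop), map_mul_invSqMeasure hc, hvol,
    Measure.prod_smul_left, Measure.prod_smul_right, smul_smul, ← ENNReal.ofReal_mul hc.le,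
    mul_inv_cancel₀ hc.ne', ENNReal.ofReal_one, one_smul]

instance : haar.IsMulLeftInvariant := ⟨fun g => by
  ext s hs
  have himage : coords '' ((g * ·) ⁻¹' s) =
      Prod.map (g.a * ·) (g.a * · + g.b) ⁻¹' (coords '' s) := by
    ext ⟨p, q⟩
    constructor
    · rintro ⟨x, hx, hxpq⟩
      exact ⟨g * x, hx, by rw [← hxpq]; rfl⟩
    · rintro ⟨y, hy, hypq⟩
      have hp : 0 < p := (mul_pos_iff_of_pos_left g.a_pos).1
        (y.a_pos.trans_eq (congrArg Prod.fst hypq))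
      let x : AxB := ⟨(p, q), hp⟩
      have hgx : g * x = y := Subtype.ext hypq.symm
      exact ⟨x, mem_preimage.2 (hgx ▸ hy), rfl⟩
  rw [Measure.map_apply (measurable_const_mul g) hs, haar_apply_prod, haar_apply_prod, himage,
    ← Measure.map_apply (by fun_prop) (measurableEmbedding_coords.measurableSet_image.2 hs),
    map_prodMap_mul_add _ _ g.a_pos]⟩

theorem haar_ne_zero_of_isOpen {U : Set AxB} (hU : IsOpen U) (hne : U.Nonempty) : haar U ≠ 0 := by
  intro hzero
  have hdensity : coords '' U ⊆ {p : ℝ × ℝ | ENNReal.ofReal (1 / p.1 ^ 2) ≠ 0} := by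
    rintro _ ⟨x, -, rfl⟩
    have := x.a_pos
    simp only [coords, Set.mem_ofPred_eq, ne_eq, ENNReal.ofReal_eq_zero, not_le]
    positivity
  rw [haar_apply, withDensity_apply_eq_zero' (by fun_prop), inter_eq_right.2 hdensity,
    (isOpenEmbedding_coords.isOpenMap U hU).measure_eq_zero_iff volume, image_eq_empty] at hzero
  exact hne.ne_empty hzero

theorem haar_isHaarMeasure : haar.IsHaarMeasure where
  lt_top_of_isCompact := (isFiniteMeasureOnCompacts_of_isLocallyFiniteMeasure).lt_top_of_isCompact
  open_pos _ hU hne := haar_ne_zero_of_isOpen hU hne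

theorem haar_not_isMulRightInvariant : ¬ haar.IsMulRightInvariant := by
  intro hinv
  let g : AxB := ⟨(2, 0), two_pos⟩
  have hpre : (· * g) ⁻¹' box (Ici 2) (Icc 0 1) = box (Ici 1) (Icc 0 1) := by
    ext x
    have ga : g.a = 2 := rfl
    have gb : g.b = 0 := rfl
    simp [box, ga, gb]
  have heq := measure_preimage_mul_right haar g (box (Ici 2) (Icc 0 1))
  rw [hpre, haar_box_Ici_Icc one_pos, haar_box_Ici_Icc two_pos,
    ENNReal.ofReal_eq_ofReal_iff (by norm_num) (by norm_num)] at heq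
  norm_num at heq

end AxB

section Chains

variable {α κ : Type*}

/-- `HasChain R S n p` says that there are points `p = p₀, p₁, …, pₙ` of `S` such that `R pᵢ pᵢ₊₁`
for every `i < n`. -/
def HasChain (R : κ → κ → Prop) (S : Set κ) : ℕ → κ → Prop
  | 0, p => p ∈ S
  | n + 1, p => p ∈ S ∧ ∃ q, R p q ∧ HasChain R S n q

namespace HasChain

variable {R : κ → κ → Prop} {S : Set κ} {n : ℕ} {p : κ}

theorem mem (h : HasChain R S n p) : p ∈ S := by
  cases n with
  | zero => exact h
  | succ n => exact h.1

theorem of_iterate {H : κ → κ} (hS : ∀ k, H^[k] p ∈ S) (hR : ∀ k, R (H^[k] p) (H^[k + 1] p))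
    (n : ℕ) : HasChain R S n p := by
  induction n generalizing p with
  | zero => exact hS 0
  | succ n ih => exact ⟨hS 0, H p, hR 0, ih (fun k => hS (k + 1)) fun k => hR (k + 1)⟩

theorem eventually_image {ι : Type*} {l : Filter ι} {R : α → α → Prop} {R' : ι → κ → κ → Prop}
    {f : ι → α → κ} (hR : ∀ x y, R x y → ∀ᶠ i in l, R' i (f i x) (f i y)) {S : Set α} {x : α}
    (h : HasChain R S n x) : ∀ᶠ i in l, HasChain (R' i) (f i '' S) n (f i x) := by
  induction n generalizing x with
  | zero => exact .of_forall fun i => Set.mem_image_of_mem _ h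
  | succ n ih =>
    obtain ⟨hx, y, hxy, hy⟩ := h
    filter_upwards [hR x y hxy, ih hy] with i hi hyi
    exact ⟨Set.mem_image_of_mem _ hx, f i y, hi, hyi⟩

end HasChain

end Chains

section Measures

variable {Ω α κ : Type*} [MeasurableSpace Ω] [MeasurableSpace α] [MeasurableSpace κ]
  [MeasurableSingletonClass κ]

theorem measure_biUnion_le_measure_preimage_mul [Countable κ] {P : Measure Ω} {μ : Measure α}
    {f : α → κ} (hf : Measurable f) {S : Set κ} {E : κ → Set Ω} {c : ℝ≥0∞}
    (hE : ∀ k ∈ S, P (E k) ≤ μ (f ⁻¹' {k}) * c) : P (⋃ k ∈ S, E k) ≤ μ (f ⁻¹' S) * c :=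
  calc P (⋃ k ∈ S, E k)
      ≤ ∑' k : S, P (E k) := measure_biUnion_le P S.to_countable E
    _ ≤ ∑' k : S, μ (f ⁻¹' {(k : κ)}) * c := ENNReal.tsum_le_tsum fun k => hE k k.2
    _ = μ (f ⁻¹' S) * c := by
      rw [ENNReal.tsum_mul_right, tsum_measure_preimage_singleton S.to_countable
        fun k _ => hf (measurableSet_singleton k)]

theorem measure_setOf_eventually_le {μ : Measure α} {s : ℕ → Set α} {c : ℝ≥0∞}
    (h : ∀ᶠ n in Filter.atTop, μ (s n) ≤ c) : μ {x | ∀ᶠ n in Filter.atTop, x ∈ s n} ≤ c := by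
  have heq : {x | ∀ᶠ n in Filter.atTop, x ∈ s n} = ⋃ k, ⋂ n ≥ k, s n := by
    ext x
    simp only [Filter.eventually_atTop, Set.mem_ofPred_eq, Set.mem_iUnion, Set.mem_iInter]
  have hmono : Monotone fun k => ⋂ n ≥ k, s n := fun k l hkl =>
    Set.biInter_subset_biInter_left fun n (hn : n ≥ l) => hkl.trans hn
  obtain ⟨K, hK⟩ := Filter.eventually_atTop.1 h
  rw [heq, hmono.measure_iUnion]
  exact iSup_le fun k => (measure_mono
    (Set.biInter_subset_of_mem (le_max_left k K : max k K ≥ k))).trans (hK _ (le_max_right k K))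

theorem exists_measurable_int_measure_preimage_le {ν : Measure ℝ} [IsFiniteMeasure ν]
    (hν : ν ≪ volume) {ε : ℝ≥0∞} (hε : ε ≠ 0) :
    ∃ f : ℝ → ℤ, Measurable f ∧ ∀ q, ν (f ⁻¹' {q}) ≤ ε := by
  have hrn := Measure.withDensity_rnDeriv_eq ν volume hν
  have hfin : ∫⁻ x, ν.rnDeriv volume x ≠ ∞ := by
    rw [← setLIntegral_univ, ← withDensity_apply _ .univ, hrn]
    exact measure_ne_top ν _
  obtain ⟨η, hη, hsmall⟩ := exists_pos_setLIntegral_lt_of_measure_lt hfin hε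
  obtain ⟨k, hk⟩ := ENNReal.exists_inv_nat_lt hη.ne'
  have hmeas : Measurable fun x : ℝ => ⌊x * ((k : ℝ) + 1)⌋ :=
    Int.measurable_floor.comp (measurable_id.mul_const _)
  refine ⟨_, hmeas, fun q => ?_⟩
  rw [← hrn, withDensity_apply _ (hmeas (measurableSet_singleton q))]
  refine (hsmall _ (lt_of_le_of_lt ?_ hk)).le
  have hpre : (fun x : ℝ => ⌊x * ((k : ℝ) + 1)⌋) ⁻¹' {q} =
      (· * ((k : ℝ) + 1)) ⁻¹' Set.Ico (q : ℝ) (q + 1) := by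
    rw [← Int.preimage_floor_singleton]
    rfl
  have hpos : (0 : ℝ) < k + 1 := by positivity
  rw [hpre, Real.volume_preimage_mul_right hpos.ne', Real.volume_Ico, add_sub_cancel_left,
    ENNReal.ofReal_one, mul_one, abs_of_pos (inv_pos.2 hpos), ENNReal.ofReal_inv_of_pos hpos]
  gcongr
  rw [← ENNReal.ofReal_natCast]
  exact ENNReal.ofReal_le_ofReal (by linarith)

end Measures

theorem tendsto_ofReal_exp_neg {ι : Type*} {l : Filter ι} {c : ι → ℝ}
    (hc : Filter.Tendsto c l Filter.atTop) :
    Filter.Tendsto (fun i => ENNReal.ofReal (Real.exp (-c i))) l (nhds 0) := by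
  rw [← ENNReal.ofReal_zero]
  exact ENNReal.tendsto_ofReal (Real.tendsto_exp_neg_atTop_nhds_zero.comp hc)

section PoissonMeasure

open scoped NNReal

theorem poissonMeasure_compl_zero_le (r : ℝ≥0) : poissonMeasure r {0}ᶜ ≤ r := by
  rw [prob_compl_eq_one_sub .of_discrete, poissonMeasure_singleton, ← ENNReal.ofReal_one,
    ← ENNReal.ofReal_sub _ (by positivity), ← ENNReal.ofReal_coe_nnreal]
  refine ENNReal.ofReal_le_ofReal ?_
  simp only [pow_zero, mul_one, Nat.factorial_zero, Nat.cast_one, div_one]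
  linarith [Real.add_one_le_exp (-r : ℝ)]

theorem poissonMeasure_compl_zero_one_le (r : ℝ≥0) : poissonMeasure r {0, 1}ᶜ ≤ r ^ 2 := by
  have hle : 1 - (Real.exp (-r) + Real.exp (-r) * r) ≤ (r : ℝ) ^ 2 := by
    nlinarith [Real.add_one_le_exp (-r : ℝ), r.coe_nonneg]
  rw [prob_compl_eq_one_sub .of_discrete, Set.insert_eq,
    measure_union (by simp) (measurableSet_singleton _), poissonMeasure_singleton,
    poissonMeasure_singleton, ← ENNReal.ofReal_add (by positivity) (by positivity),
    ← ENNReal.ofReal_one, ← ENNReal.ofReal_sub _ (by positivity), ← ENNReal.ofReal_coe_nnreal,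
    ← ENNReal.ofReal_pow r.coe_nonneg]
  exact ENNReal.ofReal_le_ofReal (by simpa using hle)

end PoissonMeasure

section PointProcesses

open Filter Set Topology
open scoped NNReal

variable {Ω α κ : Type*} [MeasurableSpace Ω] [MeasurableSpace α]

theorem sum_dirac_apply {ι : Type*} (x : ι → α) {B : Set α} (hB : MeasurableSet B) :
    Measure.sum (fun i => Measure.dirac (x i)) B = (x ⁻¹' B).encard := by
  rw [Measure.sum_apply _ hB, ← ENNReal.tsum_set_one, tsum_subtype _ fun _ => 1]
  exact tsum_congr fun i => Measure.dirac_apply' _ hB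

theorem pointsOf_sum_dirac [MeasurableSingletonClass α] {ι : Type*} (x : ι → α) :
    pointsOf (Measure.sum fun i => Measure.dirac (x i)) = range x := by
  ext y
  simp only [pointsOf, mem_ofPred_eq, sum_dirac_apply x (measurableSet_singleton y), ne_eq,
    ENat.toENNReal_eq_zero, encard_eq_zero, ← nonempty_iff_ne_empty, preimage_singleton_nonempty]

variable [TopologicalSpace α]

theorem IsPointProcess.measurable_apply {m : Ω → Measure α} {B : Set α} (h : IsPointProcess m)
    (hB : MeasurableSet B) : Measurable fun ω => m ω B :=
  (Measure.measurable_coe hB).comp h.measurable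

namespace IsPoissonProcess

variable {P : Measure Ω} {m : Ω → Measure α} {Λ : Measure α} {A B : Set α}

theorem measure_mem (h : IsPoissonProcess P m Λ) (hB : MeasurableSet B) (hΛ : Λ B ≠ ∞)
    {s : Set ℝ≥0∞} (hs : MeasurableSet s) :
    P {ω | m ω B ∈ s} = poissonMeasure (Λ B).toNNReal {k : ℕ | (k : ℝ≥0∞) ∈ s} := by
  have hlaw := congrArg (fun ν => ν s) (h.poisson B hB hΛ)
  rwa [Measure.map_apply (h.measurable_apply hB) hs,
    Measure.map_apply (by fun_prop) hs] at hlaw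

theorem measure_eq_zero (h : IsPoissonProcess P m Λ) (hB : MeasurableSet B) (hΛ : Λ B ≠ ∞) :
    P {ω | m ω B = 0} = ENNReal.ofReal (Real.exp (-(Λ B).toReal)) := by
  have hzero : {k : ℕ | (k : ℝ≥0∞) ∈ ({0} : Set ℝ≥0∞)} = {0} := by ext; simp
  have hlaw := h.measure_mem hB hΛ (measurableSet_singleton 0)
  rw [hzero, poissonMeasure_singleton] at hlaw
  simpa [ENNReal.coe_toNNReal_eq_toReal] using hlaw

theorem ae_lt_top (h : IsPoissonProcess P m Λ) (hB : MeasurableSet B) (hΛ : Λ B ≠ ∞) :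
    ∀ᵐ ω ∂P, m ω B < ∞ := by
  have hempty : {k : ℕ | (k : ℝ≥0∞) ∈ ({∞} : Set ℝ≥0∞)} = ∅ := by ext; simp
  have hlaw := h.measure_mem hB hΛ (measurableSet_singleton ∞)
  rw [hempty, measure_empty] at hlaw
  rw [ae_iff]
  simpa using hlaw

theorem measure_ne_zero_le (h : IsPoissonProcess P m Λ) (hB : MeasurableSet B) :
    P {ω | m ω B ≠ 0} ≤ Λ B := by
  rcases eq_or_ne (Λ B) ∞ with hΛ | hΛ
  · exact hΛ ▸ le_top
  have hcompl : {k : ℕ | (k : ℝ≥0∞) ∈ ({0}ᶜ : Set ℝ≥0∞)} = {0}ᶜ := by ext; simp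
  calc P {ω | m ω B ≠ 0}
      = poissonMeasure (Λ B).toNNReal {0}ᶜ :=
        hcompl ▸ h.measure_mem hB hΛ (measurableSet_singleton 0).compl
    _ ≤ Λ B := (poissonMeasure_compl_zero_le _).trans_eq (ENNReal.coe_toNNReal hΛ)

theorem measure_two_le_le (h : IsPoissonProcess P m Λ) (hB : MeasurableSet B) :
    P {ω | 2 ≤ m ω B} ≤ Λ B ^ 2 := by
  rcases eq_or_ne (Λ B) ∞ with hΛ | hΛ
  · simp [hΛ]
  have hcompl : {k : ℕ | (k : ℝ≥0∞) ∈ Ici 2} = {0, 1}ᶜ := by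
    ext k
    simp only [mem_Ici, mem_ofPred_eq, mem_compl_iff, mem_insert_iff, mem_singleton_iff]
    norm_cast
    omega
  calc P {ω | 2 ≤ m ω B}
      = poissonMeasure (Λ B).toNNReal {0, 1}ᶜ := hcompl ▸ h.measure_mem hB hΛ measurableSet_Ici
    _ ≤ Λ B ^ 2 := (poissonMeasure_compl_zero_one_le _).trans_eq (by rw [ENNReal.coe_toNNReal hΛ])

theorem iIndepFun_of_pairwise_disjoint (h : IsPoissonProcess P m Λ) {ι : Type*} {B : ι → Set α}
    (hB : ∀ i, MeasurableSet (B i)) (hd : Pairwise fun i j => Disjoint (B i) (B j)) :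
    iIndepFun (fun i ω => m ω (B i)) P := by
  refine iIndepFun_iff_finset.2 fun s => ?_
  let e := Finite.equivFin s
  have hinj : Function.Injective fun i => (e.symm i : ι) :=
    Subtype.val_injective.comp e.symm.injective
  have hind := (h.indep _ (fun i => B (e.symm i)) (fun i => hB _)
    fun i j hij => hd (hinj.ne hij)).precomp e.injective
  simpa only [Equiv.symm_apply_apply] using! hind

theorem measure_forall_ne_zero_le (h : IsPoissonProcess P m Λ) {ι : Type*} {B : ι → Set α}
    (hB : ∀ i, MeasurableSet (B i)) (hd : Pairwise fun i j => Disjoint (B i) (B j))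
    (L : Finset ι) : P {ω | ∀ i ∈ L, m ω (B i) ≠ 0} ≤ ∏ i ∈ L, Λ (B i) := by
  have hinter : {ω | ∀ i ∈ L, m ω (B i) ≠ 0} = ⋂ i ∈ L, (fun ω => m ω (B i)) ⁻¹' {0}ᶜ := by
    ext ω
    simp
  rw [hinter, (h.iIndepFun_of_pairwise_disjoint hB hd).measure_inter_preimage_eq_mul L
    fun i _ => (measurableSet_singleton 0).compl]
  exact Finset.prod_le_prod' fun i _ => h.measure_ne_zero_le (hB i)

theorem measure_ne_zero_and_eq_zero_le (h : IsPoissonProcess P m Λ) (hA : MeasurableSet A)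
    (hB : MeasurableSet B) (hd : Disjoint A B) (hΛ : Λ B ≠ ∞) :
    P {ω | m ω A ≠ 0 ∧ m ω B = 0} ≤ Λ A * ENNReal.ofReal (Real.exp (-(Λ B).toReal)) := by
  have hind := (h.iIndepFun_of_pairwise_disjoint (B := fun i : Bool => bif i then A else B)
    (by simp [hA, hB]) (pairwise_disjoint_on_bool.2 hd)).indepFun Bool.true_eq_false_eq_False
  calc P {ω | m ω A ≠ 0 ∧ m ω B = 0}
      = P {ω | m ω A ≠ 0} * P {ω | m ω B = 0} :=
        hind.measure_inter_preimage_eq_mul {0}ᶜ {0} (measurableSet_singleton 0).compl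
          (measurableSet_singleton 0)
    _ ≤ Λ A * ENNReal.ofReal (Real.exp (-(Λ B).toReal)) :=
        mul_le_mul' (h.measure_ne_zero_le hA) (h.measure_eq_zero hB hΛ).le

end IsPoissonProcess

variable [MeasurableSingletonClass α]

namespace IsPointProcess

variable {m : Ω → Measure α} {ω : Ω} {B : Set α}

theorem encard_pointsOf_inter_le (h : IsPointProcess m) (hB : MeasurableSet B) :
    ((pointsOf (m ω) ∩ B).encard : ℝ≥0∞) ≤ m ω B := by
  obtain ⟨ι, -, x, hx⟩ := h.counting ω
  rw [hx, pointsOf_sum_dirac, sum_dirac_apply x hB, inter_comm, ← image_preimage_eq_inter_range]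
  exact ENat.toENNReal_mono (encard_image_le x _)

theorem measure_ne_zero_iff (h : IsPointProcess m) (hB : MeasurableSet B) :
    m ω B ≠ 0 ↔ (pointsOf (m ω) ∩ B).Nonempty := by
  obtain ⟨ι, -, x, hx⟩ := h.counting ω
  rw [hx, pointsOf_sum_dirac, sum_dirac_apply x hB, inter_comm, ← image_preimage_eq_inter_range,
    image_nonempty, ne_eq, ENat.toENNReal_eq_zero, encard_eq_zero, nonempty_iff_ne_empty]

theorem finite_pointsOf_inter (h : IsPointProcess m) (hB : MeasurableSet B) (hfin : m ω B < ∞) :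
    (pointsOf (m ω) ∩ B).Finite :=
  encard_lt_top_iff.1 (ENat.toENNReal_lt_top.1 ((h.encard_pointsOf_inter_le hB).trans_lt hfin))

theorem measure_preimage_singleton_ne_zero_iff [MeasurableSpace κ] [MeasurableSingletonClass κ]
    (h : IsPointProcess m) {f : α → κ} (hf : Measurable f) {q : κ} :
    m ω (f ⁻¹' {q}) ≠ 0 ↔ q ∈ f '' pointsOf (m ω) :=
  h.measure_ne_zero_iff (hf (measurableSet_singleton q))

end IsPointProcess

namespace IsPoissonProcess

variable {P : Measure Ω} {m : Ω → Measure α} {Λ : Measure α} {W : Set α}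

theorem ae_nonempty_pointsOf [SigmaFinite Λ] (h : IsPoissonProcess P m Λ) (hΛ : Λ univ = ∞) :
    ∀ᵐ ω ∂P, (pointsOf (m ω)).Nonempty := by
  have hlim : Tendsto (Λ ∘ spanningSets Λ) atTop (𝓝 ∞) := by
    simpa only [iUnion_spanningSets, hΛ] using
      tendsto_measure_iUnion_atTop (μ := Λ) (monotone_spanningSets Λ)
  have hle (k : ℕ) : P {ω | ¬ (pointsOf (m ω)).Nonempty} ≤ ENNReal.ofReal (Real.exp (-k)) := by
    obtain ⟨n, hn⟩ := (ENNReal.tendsto_nhds_top_iff_nat.1 hlim k).exists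
    have hB := measurableSet_spanningSets Λ n
    have hfin := measure_spanningSets_lt_top Λ n
    have hk : (k : ℝ) ≤ (Λ (spanningSets Λ n)).toReal := by
      simpa using ENNReal.toReal_mono hfin.ne hn.le
    calc P {ω | ¬ (pointsOf (m ω)).Nonempty}
        ≤ P {ω | m ω (spanningSets Λ n) = 0} := measure_mono fun ω hω => by
          by_contra hne
          exact hω (((h.measure_ne_zero_iff hB).1 hne).mono inter_subset_left)
      _ = ENNReal.ofReal (Real.exp (-(Λ (spanningSets Λ n)).toReal)) :=
        h.measure_eq_zero hB hfin.ne
      _ ≤ ENNReal.ofReal (Real.exp (-k)) := by gcongr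
  exact le_antisymm
    (ge_of_tendsto' (tendsto_ofReal_exp_neg tendsto_natCast_atTop_atTop) hle) zero_le

variable [MeasurableSpace κ] [MeasurableSingletonClass κ] {f : α → κ}

theorem measure_subset_image_le (h : IsPoissonProcess P m Λ) (hf : Measurable f) (L : Finset κ) :
    P {ω | ↑L ⊆ f '' pointsOf (m ω)} ≤ ∏ q ∈ L, Λ (f ⁻¹' {q}) := by
  have hdisj : Pairwise fun p q => Disjoint (f ⁻¹' {p}) (f ⁻¹' {q}) := fun p q hpq =>
    (disjoint_singleton.2 hpq).preimage f
  have heq : {ω | ↑L ⊆ f '' pointsOf (m ω)} = {ω | ∀ q ∈ L, m ω (f ⁻¹' {q}) ≠ 0} := by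
    simp only [h.measure_preimage_singleton_ne_zero_iff hf, subset_def, Finset.mem_coe]
  rw [heq]
  exact h.measure_forall_ne_zero_le (fun q => hf (measurableSet_singleton q)) hdisj L

variable [Countable κ]

theorem measure_not_injOn_le (h : IsPoissonProcess P m Λ) (hW : MeasurableSet W)
    (hf : Measurable f) {ε : ℝ≥0∞} (hε : ∀ q, Λ (f ⁻¹' {q} ∩ W) ≤ ε) :
    P {ω | ¬ InjOn f (pointsOf (m ω) ∩ W)} ≤ Λ W * ε := by
  have hB (q : κ) : MeasurableSet (f ⁻¹' {q} ∩ W) := (hf (measurableSet_singleton q)).inter hW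
  calc P {ω | ¬ InjOn f (pointsOf (m ω) ∩ W)}
      ≤ P (⋃ q ∈ univ, {ω | 2 ≤ m ω (f ⁻¹' {q} ∩ W)}) := by
        refine measure_mono fun ω hω => ?_
        simp only [InjOn, mem_ofPred_eq, not_forall] at hω
        obtain ⟨x, ⟨hx, hxW⟩, y, ⟨hy, hyW⟩, hxy, hne⟩ := hω
        have hpair : ({x, y} : Set α) ⊆ pointsOf (m ω) ∩ (f ⁻¹' {f y} ∩ W) :=
          pair_subset ⟨hx, hxy, hxW⟩ ⟨hy, rfl, hyW⟩
        refine mem_iUnion₂.2 ⟨f y, mem_univ _,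
          le_trans ?_ (h.encard_pointsOf_inter_le (hB (f y)))⟩
        simpa [encard_pair hne] using ENat.toENNReal_mono (encard_le_encard hpair)
    _ ≤ Λ.restrict W (f ⁻¹' univ) * ε := by
        refine measure_biUnion_le_measure_preimage_mul hf fun q _ => ?_
        rw [Measure.restrict_apply (hf (measurableSet_singleton q))]
        refine (h.measure_two_le_le (hB q)).trans ?_
        rw [pow_two]
        gcongr
        exact hε q
    _ = Λ W * ε := by rw [preimage_univ, Measure.restrict_apply_univ]

theorem ae_injOn_of_absolutelyContinuous [SigmaFinite Λ] (h : IsPoissonProcess P m Λ)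
    {g : α → ℝ} (hg : Measurable g) (hac : Λ.map g ≪ volume) :
    ∀ᵐ ω ∂P, InjOn g (pointsOf (m ω)) := by
  have hW (i : ℕ) : ∀ᵐ ω ∂P, InjOn g (pointsOf (m ω) ∩ spanningSets Λ i) := by
    have hmeas := measurableSet_spanningSets Λ i
    have hfin := (measure_spanningSets_lt_top Λ i).ne
    have : IsFiniteMeasure (Λ.restrict (spanningSets Λ i)) := ⟨by simpa using hfin.lt_top⟩
    have hle (k : ℕ) : P {ω | ¬ InjOn g (pointsOf (m ω) ∩ spanningSets Λ i)} ≤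
        Λ (spanningSets Λ i) * (k : ℝ≥0∞)⁻¹ := by
      obtain ⟨f, hf, hsmall⟩ := exists_measurable_int_measure_preimage_le
        (ν := (Λ.restrict (spanningSets Λ i)).map g)
        ((Measure.restrict_le_self.absolutelyContinuous.map hg).trans hac)
        (ENNReal.inv_ne_zero.2 (ENNReal.natCast_ne_top k))
      refine (measure_mono ?_).trans (h.measure_not_injOn_le hmeas (hf.comp hg) fun q => ?_)
      · exact fun ω hω hinj => hω fun x hx y hy hxy => hinj hx hy (congrArg f hxy)
      · have hpre := hf (measurableSet_singleton q)
        simpa only [Measure.map_apply hg hpre, Measure.restrict_apply (hg hpre), preimage_comp]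
          using hsmall q
    have hlim := ENNReal.Tendsto.const_mul ENNReal.tendsto_inv_nat_nhds_zero
      (.inr hfin : (0 : ℝ≥0∞) ≠ 0 ∨ Λ (spanningSets Λ i) ≠ ∞)
    rw [mul_zero] at hlim
    exact le_antisymm (ge_of_tendsto' hlim hle) zero_le
  filter_upwards [ae_all_iff.2 hW] with ω hω x hx y hy hxy
  obtain ⟨i, hi⟩ := mem_iUnion.1 ((iUnion_spanningSets Λ).ge (mem_univ x))
  obtain ⟨j, hj⟩ := mem_iUnion.1 ((iUnion_spanningSets Λ).ge (mem_univ y))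
  have hmono := monotone_spanningSets Λ
  exact hω (max i j) ⟨hx, hmono (le_max_left i j) hi⟩ ⟨hy, hmono (le_max_right i j) hj⟩ hxy

theorem measure_exists_measure_eq_zero_le (h : IsPoissonProcess P m Λ) (hW : MeasurableSet W)
    (hf : Measurable f) {U : κ → Set α} (hU : ∀ q, MeasurableSet (U q))
    (hd : ∀ q, Disjoint W (U q)) {c : ℝ≥0} (hΛ : ∀ q, Λ (U q) = c) :
    P {ω | ∃ y ∈ pointsOf (m ω) ∩ W, m ω (U (f y)) = 0} ≤
      Λ W * ENNReal.ofReal (Real.exp (-c)) := by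
  have hB (q : κ) : MeasurableSet (f ⁻¹' {q} ∩ W) := (hf (measurableSet_singleton q)).inter hW
  calc P {ω | ∃ y ∈ pointsOf (m ω) ∩ W, m ω (U (f y)) = 0}
      ≤ P (⋃ q ∈ univ, {ω | m ω (f ⁻¹' {q} ∩ W) ≠ 0 ∧ m ω (U q) = 0}) := by
        refine measure_mono ?_
        rintro ω ⟨y, ⟨hy, hyW⟩, hzero⟩
        exact mem_iUnion₂.2 ⟨f y, mem_univ _,
          (h.measure_ne_zero_iff (hB _)).2 ⟨y, hy, rfl, hyW⟩, hzero⟩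
    _ ≤ Λ.restrict W (f ⁻¹' univ) * ENNReal.ofReal (Real.exp (-c)) := by
        refine measure_biUnion_le_measure_preimage_mul hf fun q _ => ?_
        rw [Measure.restrict_apply (hf (measurableSet_singleton q))]
        have hle := h.measure_ne_zero_and_eq_zero_le (hB q) (hU q)
          ((hd q).mono_left inter_subset_right) (by simp [hΛ])
        rwa [hΛ, ENNReal.coe_toReal] at hle
    _ = Λ W * ENNReal.ofReal (Real.exp (-c)) := by
        rw [preimage_univ, Measure.restrict_apply_univ]

section HasChain

variable {β : Type*} [Preorder β] {rank : κ → β} {R : κ → κ → Prop}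

theorem measure_subset_image_hasChain_le (h : IsPoissonProcess P m Λ) (hf : Measurable f)
    (hrank : ∀ p q, R p q → rank p < rank q) {r : ℝ≥0∞} (hr : ∀ p, Λ (f ⁻¹' {q | R p q}) ≤ r)
    (n : ℕ) (p : κ) (L : Finset κ) (hL : ∀ q ∈ L, rank q ≤ rank p) :
    P {ω | ↑L ⊆ f '' pointsOf (m ω) ∧ HasChain R (f '' pointsOf (m ω)) n p} ≤
      (∏ q ∈ L, Λ (f ⁻¹' {q})) * r ^ n := by
  induction n generalizing p L with
  | zero =>
    rw [pow_zero, mul_one]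
    exact (measure_mono fun ω hω => hω.1).trans (h.measure_subset_image_le hf L)
  | succ n ih =>
    set E : κ → Set Ω := fun q =>
      {ω | insert q ↑L ⊆ f '' pointsOf (m ω) ∧ HasChain R (f '' pointsOf (m ω)) n q} with hE
    have hstep (q : κ) (hq : R p q) :
        P (E q) ≤ Λ (f ⁻¹' {q}) * ((∏ q ∈ L, Λ (f ⁻¹' {q})) * r ^ n) := by
      have hlt (q' : κ) (hq' : q' ∈ L) : rank q' < rank q := (hL q' hq').trans_lt (hrank p q hq)
      have hnotMem : q ∉ L := fun hmem => (hlt q hmem).false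
      simpa only [hE, Finset.coe_cons, Finset.prod_cons, mul_assoc] using
        ih q (L.cons q hnotMem)
          ((Finset.forall_mem_cons hnotMem _).2 ⟨le_rfl, fun q' hq' => (hlt q' hq').le⟩)
    calc P {ω | ↑L ⊆ f '' pointsOf (m ω) ∧ HasChain R (f '' pointsOf (m ω)) (n + 1) p}
        ≤ P (⋃ q ∈ {q | R p q}, E q) := by
          refine measure_mono ?_
          rintro ω ⟨hLω, -, q, hpq, hchain⟩
          exact mem_iUnion₂.2 ⟨q, hpq, insert_subset hchain.mem hLω, hchain⟩
      _ ≤ Λ (f ⁻¹' {q | R p q}) * ((∏ q ∈ L, Λ (f ⁻¹' {q})) * r ^ n) :=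
          measure_biUnion_le_measure_preimage_mul hf hstep
      _ ≤ r * ((∏ q ∈ L, Λ (f ⁻¹' {q})) * r ^ n) := by gcongr; exact hr p
      _ = (∏ q ∈ L, Λ (f ⁻¹' {q})) * r ^ (n + 1) := by ring

theorem measure_exists_hasChain_le (h : IsPoissonProcess P m Λ) (hf : Measurable f)
    (hrank : ∀ p q, R p q → rank p < rank q) {r : ℝ≥0∞} (hr : ∀ p, Λ (f ⁻¹' {q | R p q}) ≤ r)
    (n : ℕ) (S : Set κ) :
    P {ω | ∃ p ∈ S, HasChain R (f '' pointsOf (m ω)) n p} ≤ Λ (f ⁻¹' S) * r ^ n := by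
  have hsingleton (p : κ) (_ : p ∈ S) : P {ω | HasChain R (f '' pointsOf (m ω)) n p} ≤
      Λ (f ⁻¹' {p}) * r ^ n := by
    rw [← Finset.prod_singleton (fun q => Λ (f ⁻¹' {q})) p]
    refine (measure_mono ?_).trans
      (h.measure_subset_image_hasChain_le hf hrank hr n p {p} (by simp))
    exact fun ω hω => ⟨by simpa using hω.mem, hω⟩
  refine (measure_mono ?_).trans (measure_biUnion_le_measure_preimage_mul hf hsingleton)
  rintro ω ⟨p, hp, hchain⟩
  exact mem_iUnion₂.2 ⟨p, hp, hchain⟩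

end HasChain

end IsPoissonProcess

end PointProcesses

namespace AxB

open Set Filter Topology
open scoped NNReal

section Steps

variable {δ s : ℝ} {x y : AxB}

/-- The index of the square of the grid of mesh `1 / s` that contains `x`. -/
noncomputable def cell (s : ℝ) (x : AxB) : ℤ × ℤ := (⌊x.a * s⌋, ⌊x.b * s⌋)

theorem measurable_cell (s : ℝ) : Measurable (cell s) :=
  (Int.measurable_floor.comp (measurable_a.mul_const _)).prodMk
    (Int.measurable_floor.comp (measurable_b.mul_const _))

theorem cell_eq_iff (hs : 0 < s) {p : ℤ × ℤ} :
    cell s x = p ↔ (p.1 / s ≤ x.a ∧ x.a < (p.1 + 1) / s) ∧ p.2 / s ≤ x.b ∧ x.b < (p.2 + 1) / s := by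
  rw [div_le_iff₀ hs, lt_div_iff₀ hs, div_le_iff₀ hs, lt_div_iff₀ hs, ← Int.floor_eq_iff,
    ← Int.floor_eq_iff]
  exact Prod.ext_iff

theorem eventually_preimage_cell_subset {U : Set AxB} (hU : U ∈ 𝓝 x) :
    ∀ᶠ k : ℕ in atTop, cell k ⁻¹' {cell k x} ⊆ U := by
  rw [isOpenEmbedding_coords.nhds_eq_comap, mem_comap] at hU
  obtain ⟨V, hV, hVU⟩ := hU
  obtain ⟨ε, hε, hball⟩ := Metric.mem_nhds_iff.1 hV
  filter_upwards [(tendsto_natCast_atTop_atTop.const_mul_atTop hε).eventually_ge_atTop 1]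
    with k hk z hz
  have hk0 : (0 : ℝ) < k := pos_of_mul_pos_right (one_pos.trans_le hk) hε.le
  have hlt {u v : ℝ} (huv : ⌊u * k⌋ = ⌊v * k⌋) : |u - v| < ε := by
    have habs := Int.abs_sub_lt_one_of_floor_eq_floor huv
    rw [← sub_mul, abs_mul, abs_of_pos hk0] at habs
    exact lt_of_mul_lt_mul_right (habs.trans_le hk) hk0.le
  exact hVU (hball (max_lt (hlt (congrArg Prod.fst hz)) (hlt (congrArg Prod.snd hz))))

/-- The point `y` lies in the strip at `x`, strictly to the right of `x`. In the absence of ties,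
these are the moves of a strip point-shift away from its fixed points. -/
def StrictStep (δ : ℝ) (x y : AxB) : Prop := y ∈ strip δ x ∧ x.a < y.a

/-- `CellStep δ s M p q` says that `q` lies in a later column than `p` in the grid of mesh `1 / s`
and meets the strip at some point of `p`. Discarding the columns before the `M`-th one makes the
measure of the squares reached in one step close to that of a strip. -/
def CellStep (δ s : ℝ) (M : ℕ) (p q : ℤ × ℤ) : Prop :=
  M ≤ p.1 ∧ p.1 < q.1 ∧ ∃ x y, cell s x = p ∧ cell s y = q ∧ y ∈ strip δ x

theorem StrictStep.eventually_cellStep (h : StrictStep δ x y) (M : ℕ) :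
    ∀ᶠ k : ℕ in atTop, CellStep δ k M (cell k x) (cell k y) := by
  have hcolumn := (tendsto_natCast_atTop_atTop.const_mul_atTop x.a_pos).eventually_ge_atTop (M : ℝ)
  have hlater :=
    (tendsto_natCast_atTop_atTop.const_mul_atTop (sub_pos.2 h.2)).eventually_ge_atTop (1 : ℝ)
  filter_upwards [hcolumn, hlater] with k hM hk
  refine ⟨Int.le_floor.2 (by exact_mod_cast hM), ?_, x, y, rfl, rfl, h.1⟩
  rw [cell, cell, Int.lt_iff_add_one_le, Int.le_floor]
  push_cast
  linarith [Int.floor_le (x.a * k)]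

theorem preimage_cell_cellStep_subset (hδ : 0 ≤ δ) (hs : 0 < s) (M : ℕ) (p : ℤ × ℤ) :
    cell s ⁻¹' {q | CellStep δ s M p q} ⊆
      box (Ici ((p.1 + 1) / s)) (Icc ((p.2 - 1) / s - δ * ((p.1 + 1) / s))
        ((p.2 + 2) / s + δ * ((p.1 + 1) / s))) := by
  rintro z ⟨-, hlt, x, y, hx, hy, -, hyb⟩
  obtain ⟨⟨-, hxa⟩, hxb⟩ := (cell_eq_iff hs).1 hx
  obtain ⟨-, hyb'⟩ := (cell_eq_iff hs).1 hy
  obtain ⟨⟨hza, -⟩, hzb⟩ := (cell_eq_iff hs).1 (rfl : cell s z = _)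
  have hwidth := mul_le_mul_of_nonneg_left hxa.le hδ
  have hcol : (p.1 + 1 : ℝ) ≤ (cell s z).1 := by exact_mod_cast hlt
  refine ⟨le_trans (by gcongr) hza, ?_, ?_⟩
  all_goals
    simp only [add_div, sub_div] at *
    linarith [show (2 : ℝ) / s = 1 / s + 1 / s by ring]

theorem haar_preimage_cell_cellStep_le (hδ : 0 ≤ δ) (hs : 0 < s) (M : ℕ) (p : ℤ × ℤ) :
    haar (cell s ⁻¹' {q | CellStep δ s M p q}) ≤ ENNReal.ofReal (2 * δ + 3 / (M + 1)) := by
  by_cases hM : (M : ℤ) ≤ p.1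
  · have hM' : (M : ℝ) ≤ p.1 := by exact_mod_cast hM
    have hp : (0 : ℝ) < p.1 + 1 := by linarith [M.cast_nonneg (α := ℝ)]
    refine (measure_mono (preimage_cell_cellStep_subset hδ hs M p)).trans ?_
    rw [haar_box_Ici_Icc (by positivity)]
    have hratio : ((p.2 + 2) / s + δ * ((p.1 + 1) / s) - ((p.2 - 1) / s - δ * ((p.1 + 1) / s))) /
        ((p.1 + 1) / s) = 2 * δ + 3 / (p.1 + 1) := by
      field_simp
      ring
    rw [hratio]
    gcongr
  · have hempty : {q | CellStep δ s M p q} = ∅ := eq_empty_of_forall_notMem fun q hq => hM hq.1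
    simp [hempty]

end Steps

section Cone

variable {δ c : ℝ} {j : ℕ}

/-- The `j`-th of infinitely many disjoint boxes of equal measure, in the region
`|b - c| ≤ δ a / 2`. -/
def coneCell (δ c : ℝ) (j : ℕ) : Set AxB :=
  box (Ico (1 / 2 ^ (j + 1)) (1 / 2 ^ j)) (Icc (c - δ / 2 ^ (j + 2)) (c + δ / 2 ^ (j + 2)))

theorem measurableSet_coneCell : MeasurableSet (coneCell δ c j) :=
  measurableSet_box measurableSet_Ico measurableSet_Icc

theorem haar_coneCell : haar (coneCell δ c j) = ENNReal.ofReal (δ / 2) := by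
  rw [coneCell, haar_box_Ico_Icc (by positivity)
    (one_div_le_one_div_of_le (by positivity) (pow_le_pow_right₀ one_le_two (j.le_add_right 1)))]
  congr 1
  field_simp
  ring

theorem pairwise_disjoint_coneCell :
    Pairwise fun i j => Disjoint (coneCell δ c i) (coneCell δ c j) := by
  refine (pairwise_disjoint_on _).2 fun i j hij => ?_
  refine disjoint_left.2 fun x hi hj => (hj.1.2.trans_le ?_).not_ge hi.1.1
  exact one_div_le_one_div_of_le (by positivity) (pow_le_pow_right₀ one_le_two hij)

theorem haar_biUnion_coneCell (J n : ℕ) :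
    haar (⋃ j ∈ Finset.Ico J (J + n), coneCell δ c j) = n * ENNReal.ofReal (δ / 2) := by
  rw [measure_biUnion_finset (pairwise_disjoint_coneCell.set_pairwise _)
    fun _ _ => measurableSet_coneCell]
  simp [haar_coneCell]

theorem abs_sub_le_of_mem_coneCell (hδ : 0 ≤ δ) {x : AxB} (hx : x ∈ coneCell δ c j) {t : ℝ}
    (ht : |t - c| ≤ δ / 2 ^ (j + 2)) : |x.b - t| ≤ δ * x.a := by
  have hxc : |x.b - c| ≤ δ / 2 ^ (j + 2) :=
    abs_sub_le_iff.2 ⟨by linarith [hx.2.2], by linarith [hx.2.1]⟩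
  calc |x.b - t| ≤ |x.b - c| + |c - t| := abs_sub_le _ _ _
    _ ≤ δ / 2 ^ (j + 2) + δ / 2 ^ (j + 2) := add_le_add hxc (abs_sub_comm c t ▸ ht)
    _ = δ * (1 / 2 ^ (j + 1)) := by ring
    _ ≤ δ * x.a := mul_le_mul_of_nonneg_left hx.1.1 hδ

theorem abs_sub_floor_div_mul_le {η : ℝ} (hη : 0 < η) (t : ℝ) : |t - ⌊t / η⌋ * η| ≤ η := by
  have heq : t - ⌊t / η⌋ * η = Int.fract (t / η) * η := by
    rw [Int.fract, sub_mul, div_mul_cancel₀ _ hη.ne']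
  rw [heq, abs_of_nonneg (mul_nonneg (Int.fract_nonneg _) hη.le)]
  exact mul_le_of_le_one_left hη.le (Int.fract_lt_one _).le

end Cone

variable {Ω : Type*} [MeasurableSpace Ω] {P : Measure Ω} {m : Ω → Measure AxB} {lam δ : ℝ}

instance : IsLocallyFiniteMeasure (ENNReal.ofReal lam • haar) :=
  inferInstanceAs (IsLocallyFiniteMeasure (lam.toNNReal • haar))

theorem ae_forall_strip_lt_top (hm : IsPoissonProcess P m (ENNReal.ofReal lam • haar)) :
    ∀ᵐ ω ∂P, ∀ x, m ω (strip δ x) < ∞ := by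
  have hbox (T : ℕ) : ∀ᵐ ω ∂P, m ω (box (Ici (1 / (T + 1))) (Icc (-T) T)) < ∞ := by
    refine hm.ae_lt_top (measurableSet_box measurableSet_Ici measurableSet_Icc) ?_
    rw [Measure.smul_apply, haar_box_Ici_Icc (by positivity)]
    exact ENNReal.mul_ne_top ENNReal.ofReal_ne_top ENNReal.ofReal_ne_top
  filter_upwards [ae_all_iff.2 hbox] with ω hω x
  obtain ⟨T, hT⟩ := exists_nat_ge (max (1 / x.a) (max (-(x.b - δ * x.a)) (x.b + δ * x.a)))
  obtain ⟨ha, hb⟩ := max_le_iff.1 hT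
  obtain ⟨hlower, hupper⟩ := max_le_iff.1 hb
  refine (measure_mono ?_).trans_lt (hω T)
  rw [strip_eq_box]
  refine box_subset_box (Ici_subset_Ici.2 ?_) (Icc_subset_Icc (neg_le.1 hlower) hupper)
  exact (one_div_le (by positivity) x.a_pos).2 (ha.trans (lt_add_one _).le)

theorem ae_injOn_a (hm : IsPoissonProcess P m (ENNReal.ofReal lam • haar)) :
    ∀ᵐ ω ∂P, InjOn a (pointsOf (m ω)) := by
  refine hm.ae_injOn_of_absolutelyContinuous measurable_a ?_
  rw [Measure.map_smul]
  exact map_a_haar_absolutelyContinuous.smul_left _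

theorem measure_exists_hasChain_strictStep_le
    (hm : IsPoissonProcess P m (ENNReal.ofReal lam • haar)) (hlam : 0 ≤ lam) (hδ : 0 ≤ δ) {r : ℝ}
    (hr : 2 * δ * lam < r) {U : Set AxB} (hU : IsOpen U) (n : ℕ) :
    P {ω | ∃ x ∈ U, HasChain (StrictStep δ) (pointsOf (m ω)) n x} ≤
      (ENNReal.ofReal lam • haar) U * ENNReal.ofReal r ^ n := by
  obtain ⟨M, hM⟩ := exists_nat_gt (3 * lam / (r - 2 * δ * lam))
  have hMr : lam * (2 * δ + 3 / (M + 1)) ≤ r := by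
    have hdiv : 3 * lam / (M + 1) ≤ r - 2 * δ * lam := by
      rw [div_le_comm₀ (by positivity) (sub_pos.2 hr)]
      exact hM.le.trans (lt_add_one _).le
    calc lam * (2 * δ + 3 / (M + 1)) = 2 * δ * lam + 3 * lam / (M + 1) := by ring
      _ ≤ r := by linarith
  have hgrid : ∀ᶠ k : ℕ in atTop, P {ω | ∃ p ∈ {p | cell k ⁻¹' {p} ⊆ U},
      HasChain (CellStep δ k M) (cell k '' pointsOf (m ω)) n p} ≤
        (ENNReal.ofReal lam • haar) U * ENNReal.ofReal r ^ n := by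
    filter_upwards [eventually_gt_atTop 0] with k hk
    refine (hm.measure_exists_hasChain_le (rank := Prod.fst) (measurable_cell k)
      (fun p q h => h.2.1) (r := ENNReal.ofReal r) (fun p => ?_) n _).trans ?_
    · refine le_trans ?_ (ENNReal.ofReal_le_ofReal hMr)
      rw [Measure.smul_apply, smul_eq_mul, ENNReal.ofReal_mul hlam]
      gcongr
      exact haar_preimage_cell_cellStep_le hδ (Nat.cast_pos.2 hk) M p
    · gcongr
      exact fun x hx => hx rfl
  refine (measure_mono ?_).trans (measure_setOf_eventually_le hgrid)
  rintro ω ⟨x, hxU, hx⟩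
  filter_upwards [eventually_preimage_cell_subset (hU.mem_nhds hxU),
    hx.eventually_image fun x y h => h.eventually_cellStep M] with k hkU hk
  exact ⟨cell k x, hkU, hk⟩

theorem ae_forall_exists_not_hasChain (hm : IsPoissonProcess P m (ENNReal.ofReal lam • haar))
    (hlam : 0 ≤ lam) (hδ : 0 ≤ δ) (hsub : 2 * δ * lam < 1) :
    ∀ᵐ ω ∂P, ∀ x, ∃ n, ¬ HasChain (StrictStep δ) (pointsOf (m ω)) n x := by
  obtain ⟨r, hr, hr1⟩ := exists_between hsub
  let K := (ENNReal.ofReal lam • haar).finiteSpanningSetsInOpen'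
  have hK (i : ℕ) : ∀ᵐ ω ∂P, ∀ x ∈ K.set i,
      ∃ n, ¬ HasChain (StrictStep δ) (pointsOf (m ω)) n x := by
    have hle (n : ℕ) :
        P {ω | ¬ ∀ x ∈ K.set i, ∃ n, ¬ HasChain (StrictStep δ) (pointsOf (m ω)) n x} ≤
          (ENNReal.ofReal lam • haar) (K.set i) * ENNReal.ofReal r ^ n := by
      refine (measure_mono fun ω hω => ?_).trans
        (measure_exists_hasChain_strictStep_le hm hlam hδ hr (K.set_mem i) n)
      simp only [mem_ofPred_eq, not_forall, not_exists, not_not] at hω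
      obtain ⟨x, hx, hchain⟩ := hω
      exact ⟨x, hx, hchain n⟩
    have hlim := ENNReal.Tendsto.const_mul (ENNReal.tendsto_pow_atTop_nhds_zero_of_lt_one
      (ENNReal.ofReal_lt_one.2 hr1)) (.inr (K.finite i).ne)
    rw [mul_zero] at hlim
    exact le_antisymm (ge_of_tendsto' hlim hle) zero_le
  filter_upwards [ae_all_iff.2 hK] with ω hω x
  obtain ⟨i, hi⟩ := mem_iUnion.1 (K.spanning.ge (mem_univ x))
  exact hω i x hi

theorem measure_exists_forall_not_mem_cone_le
    (hm : IsPoissonProcess P m (ENNReal.ofReal lam • haar)) (hδ : 0 < δ) {J : ℕ} {W : Set AxB}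
    (hW : MeasurableSet W) (hWJ : ∀ y ∈ W, 1 / 2 ^ J ≤ y.a) (n : ℕ) :
    P {ω | ∃ y ∈ pointsOf (m ω) ∩ W,
        ∀ x ∈ pointsOf (m ω), x.a < 1 / 2 ^ J → ¬ |x.b - y.b| ≤ δ * x.a} ≤
      (ENNReal.ofReal lam • haar) W *
        ENNReal.ofReal (Real.exp (-(n * (lam.toNNReal * (δ / 2).toNNReal) : ℝ≥0))) := by
  set η : ℝ := δ / 2 ^ (J + n + 1) with hη
  set U : ℤ → Set AxB := fun q => ⋃ j ∈ Finset.Ico J (J + n), coneCell δ (q * η) j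
  have hUmeas (q : ℤ) : MeasurableSet (U q) :=
    Finset.measurableSet_biUnion _ fun _ _ => measurableSet_coneCell
  have hUlt {q : ℤ} {x : AxB} (hx : x ∈ U q) : x.a < 1 / 2 ^ J := by
    obtain ⟨j, hj, hxj⟩ := mem_iUnion₂.1 hx
    exact hxj.1.2.trans_le (one_div_le_one_div_of_le (by positivity)
      (pow_le_pow_right₀ one_le_two (Finset.mem_Ico.1 hj).1))
  have hUΛ (q : ℤ) : (ENNReal.ofReal lam • haar) (U q) =
      (n * (lam.toNNReal * (δ / 2).toNNReal) : ℝ≥0) := by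
    rw [Measure.smul_apply, haar_biUnion_coneCell, smul_eq_mul, mul_left_comm]
    push_cast
    rfl
  have hfloor : Measurable fun y : AxB => ⌊y.b / η⌋ :=
    Int.measurable_floor.comp (measurable_b.div_const η)
  refine (measure_mono ?_).trans (hm.measure_exists_measure_eq_zero_le hW hfloor hUmeas
    (fun q => disjoint_left.2 fun y hy hyU => (hUlt hyU).not_ge (hWJ y hy)) hUΛ)
  rintro ω ⟨y, hy, hempty⟩
  refine ⟨y, hy, ?_⟩
  by_contra hne
  obtain ⟨x, hxN, hxU⟩ := (hm.measure_ne_zero_iff (hUmeas _)).1 hne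
  obtain ⟨j, hj, hxj⟩ := mem_iUnion₂.1 hxU
  refine hempty x hxN (hUlt hxU) (abs_sub_le_of_mem_coneCell hδ.le hxj ?_)
  refine (abs_sub_floor_div_mul_le (by positivity) y.b).trans ?_
  have hjn : j + 2 ≤ J + n + 1 := by have := (Finset.mem_Ico.1 hj).2; omega
  rw [hη]
  gcongr
  exact one_le_two

theorem ae_forall_exists_mem_cone (hm : IsPoissonProcess P m (ENNReal.ofReal lam • haar))
    (hlam : 0 < lam) (hδ : 0 < δ) :
    ∀ᵐ ω ∂P, ∀ y ∈ pointsOf (m ω), ∀ ε > 0,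
      ∃ x ∈ pointsOf (m ω), x.a < ε ∧ |x.b - y.b| ≤ δ * x.a := by
  set Λ := ENNReal.ofReal lam • haar
  have hJi (J i : ℕ) : ∀ᵐ ω ∂P, ∀ y ∈ pointsOf (m ω) ∩ (spanningSets Λ i ∩ a ⁻¹' Ici (1 / 2 ^ J)),
      ∃ x ∈ pointsOf (m ω), x.a < 1 / 2 ^ J ∧ |x.b - y.b| ≤ δ * x.a := by
    have hW := (measurableSet_spanningSets Λ i).inter
      (measurable_a (measurableSet_Ici (a := (1 / 2 ^ J : ℝ))))
    have hfin := measure_ne_top_of_subset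
      (inter_subset_left (t := a ⁻¹' Ici (1 / 2 ^ J))) (measure_spanningSets_lt_top Λ i).ne
    have hlim := ENNReal.Tendsto.const_mul (tendsto_ofReal_exp_neg
      (tendsto_natCast_atTop_atTop.atTop_mul_const
        (mul_pos hlam (half_pos hδ)))) (.inr hfin)
    rw [mul_zero] at hlim
    refine le_antisymm (ge_of_tendsto' hlim fun n => (measure_mono ?_).trans
      ((measure_exists_forall_not_mem_cone_le hm hδ hW (fun y hy => hy.2) n).trans_eq ?_)) zero_le
    · intro ω hω
      simpa only [mem_compl_iff, mem_ofPred_eq, not_forall, not_exists, not_and, exists_prop]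
        using! hω
    · simp only [NNReal.coe_mul, NNReal.coe_natCast]
      rw [Real.coe_toNNReal _ hlam.le, Real.coe_toNNReal _ (half_pos hδ).le]
  filter_upwards [ae_all_iff.2 fun J => ae_all_iff.2 (hJi J)] with ω hω y hy ε hε
  obtain ⟨J, hJ⟩ := exists_pow_lt_of_lt_one (lt_min hε y.a_pos) one_half_lt_one
  rw [one_div_pow, lt_min_iff] at hJ
  obtain ⟨i, hi⟩ := mem_iUnion.1 ((iUnion_spanningSets Λ).ge (mem_univ y))
  obtain ⟨x, hx, hxJ, hxy⟩ := hω J i y ⟨hy, hi, hJ.2.le⟩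
  exact ⟨x, hx, hxJ.trans hJ.1, hxy⟩

end AxB

namespace AxB

section Generic

variable {Ω : Type*} [MeasurableSpace Ω] {P : Measure Ω} {m : Ω → Measure AxB} {lam δ : ℝ}

/-- The deterministic properties of a configuration on which the analysis of the strip point-shift
rests; they hold almost surely for a Poisson process of intensity `lam • haar` if
`2 * δ * lam < 1`. -/
structure IsGeneric (δ : ℝ) (N : Set AxB) : Prop where
  nonempty : N.Nonempty
  finite_inter_strip (x : AxB) : (N ∩ strip δ x).Finite
  injOn_a : Set.InjOn a N
  exists_not_hasChain (x : AxB) : ∃ n, ¬ HasChain (StrictStep δ) N n x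
  exists_mem_cone {y : AxB} (hy : y ∈ N) {ε : ℝ} (hε : 0 < ε) :
    ∃ x ∈ N, x.a < ε ∧ |x.b - y.b| ≤ δ * x.a

theorem ae_isGeneric_pointsOf (hm : IsPoissonProcess P m (ENNReal.ofReal lam • haar))
    (hlam : 0 < lam) (hδ : 0 < δ) (hsub : 2 * δ * lam < 1) :
    ∀ᵐ ω ∂P, IsGeneric δ (pointsOf (m ω)) := by
  have hinfinite : (ENNReal.ofReal lam • haar) Set.univ = ∞ := by
    rw [Measure.smul_apply, haar_univ, smul_eq_mul,
      ENNReal.mul_top (ENNReal.ofReal_pos.2 hlam).ne']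
  filter_upwards [hm.ae_nonempty_pointsOf hinfinite, ae_forall_strip_lt_top (δ := δ) hm,
    ae_injOn_a hm, ae_forall_exists_not_hasChain hm hlam.le hδ.le hsub,
    ae_forall_exists_mem_cone hm hlam hδ] with ω hne hstrip hinj hchain hcone
  exact ⟨hne, fun x => hm.finite_pointsOf_inter
    (measurableSet_box measurableSet_Ici measurableSet_Icc) (hstrip x), hinj, hchain,
    fun hy _ hε => hcone _ hy _ hε⟩

end Generic

theorem mem_strip_self {δ : ℝ} (hδ : 0 ≤ δ) (x : AxB) : x ∈ strip δ x := by
  have := mul_nonneg hδ x.a_pos.le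
  exact ⟨le_rfl, by linarith, by linarith⟩

theorem IsRightmost.le {δ : ℝ} {N : Set AxB} {x y z : AxB} (h : IsRightmost δ N x y)
    (hz : z ∈ N ∩ strip δ x) : z.a ≤ y.a :=
  (h.2 z hz).elim LT.lt.le fun heq => heq.1.le

namespace IsGeneric

variable {N : Set AxB} {δ : ℝ} {x y : AxB}

theorem isRightmost_stripShift (h : IsGeneric δ N) (hδ : 0 ≤ δ) (hx : x ∈ N) :
    IsRightmost δ N x (stripShift δ N x) := by
  obtain ⟨y, hy, hmax⟩ :=
    Set.exists_max_image _ a (h.finite_inter_strip x) ⟨x, hx, mem_strip_self hδ x⟩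
  have hex : x ∈ N ∧ ∃ y, IsRightmost δ N x y := by
    refine ⟨hx, y, hy, fun z hz => (hmax z hz).lt_or_eq.imp_right fun heq => ?_⟩
    rw [h.injOn_a hz.1 hy.1 heq]
    exact ⟨rfl, le_rfl⟩
  rw [stripShift, dif_pos hex]
  exact hex.2.choose_spec

theorem mapsTo_stripShift (h : IsGeneric δ N) (hδ : 0 ≤ δ) : Set.MapsTo (stripShift δ N) N N :=
  fun _ hx => (h.isRightmost_stripShift hδ hx).1.1

theorem lt_of_ne_stripShift (h : IsGeneric δ N) (hδ : 0 ≤ δ) (hx : x ∈ N)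
    (hy : y ∈ N ∩ strip δ x) (hne : y ≠ stripShift δ N x) : y.a < (stripShift δ N x).a :=
  ((h.isRightmost_stripShift hδ hx).le hy).lt_of_ne fun heq =>
    hne (h.injOn_a hy.1 (h.mapsTo_stripShift hδ hx) heq)

theorem strictStep_stripShift (h : IsGeneric δ N) (hδ : 0 ≤ δ) (hx : x ∈ N)
    (hne : stripShift δ N x ≠ x) : StrictStep δ x (stripShift δ N x) :=
  ⟨(h.isRightmost_stripShift hδ hx).1.2,
    h.lt_of_ne_stripShift hδ hx ⟨hx, mem_strip_self hδ x⟩ hne.symm⟩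

theorem exists_isFixedPt_iterate (h : IsGeneric δ N) (hδ : 0 ≤ δ) (hx : x ∈ N) :
    ∃ k, Function.IsFixedPt (stripShift δ N) ((stripShift δ N)^[k] x) := by
  by_contra! hmoves
  have hmem (k : ℕ) : (stripShift δ N)^[k] x ∈ N := (h.mapsTo_stripShift hδ).iterate k hx
  obtain ⟨n, hn⟩ := h.exists_not_hasChain x
  refine hn (HasChain.of_iterate hmem (fun k => ?_) n)
  rw [Function.iterate_succ_apply']
  exact h.strictStep_stripShift hδ (hmem k) (hmoves k)

theorem stripShift_eq_of_mem_cone (h : IsGeneric δ N) (hδ : 0 ≤ δ)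
    (hy : y ∈ PointShift.fixedPts N (stripShift δ N)) (hx : x ∈ N) (ha : x.a ≤ y.a / 2)
    (hb : |x.b - y.b| ≤ δ * x.a) : stripShift δ N x = y := by
  obtain ⟨hlower, hupper⟩ := abs_le.1 hb
  have hright := h.isRightmost_stripShift hδ hx
  have hyx : y ∈ strip δ x := ⟨by linarith [y.a_pos], by linarith, by linarith⟩
  have hle : y.a ≤ (stripShift δ N x).a := hright.le ⟨hy.1, hyx⟩
  -- The two strips have half-widths `δ x.a` and `δ y.a ≥ 2 δ x.a`, and their axes are within
  -- `δ x.a`, so to the right of `y` the strip at `x` is contained in that at `y`.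
  have hstrip : stripShift δ N x ∈ strip δ y := by
    have hwidth := mul_le_mul_of_nonneg_left ha hδ
    exact ⟨hle, by linarith [hright.1.2.2.1], by linarith [hright.1.2.2.2]⟩
  have hge := (h.isRightmost_stripShift hδ hy.1).le ⟨hright.1.1, hstrip⟩
  rw [hy.2] at hge
  exact h.injOn_a hright.1.1 hy.1 (hge.antisymm hle)

theorem infinite_stripShift_eq (h : IsGeneric δ N) (hδ : 0 ≤ δ)
    (hy : y ∈ PointShift.fixedPts N (stripShift δ N)) :
    {x ∈ N | stripShift δ N x = y}.Infinite := by
  intro hfinite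
  obtain ⟨z, -, hmin⟩ := Set.exists_min_image _ a hfinite ⟨y, hy⟩
  obtain ⟨x, hx, hxa, hxb⟩ := h.exists_mem_cone hy.1 (lt_min z.a_pos (half_pos y.a_pos))
  obtain ⟨hxz, hxy⟩ := lt_min_iff.1 hxa
  exact (hmin x ⟨hx, h.stripShift_eq_of_mem_cone hδ hy hx hxy.le hxb⟩).not_gt hxz

end IsGeneric

end AxB

namespace PointShift

open Function

variable {α : Type*} {N C : Set α} {H : α → α} {x y : α}

theorem iterate_eq_of_le {k n : ℕ} (hk : IsFixedPt H (H^[k] x)) (hkn : k ≤ n) :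
    H^[n] x = H^[k] x := by
  obtain ⟨j, rfl⟩ := Nat.exists_eq_add_of_le' hkn
  rw [iterate_add_apply, hk.iterate j]

theorem fixedPts_subset_primeval : fixedPts N H ⊆ primeval N H := fun y hy =>
  Set.mem_iInter.2 fun n => ⟨y, hy.1, IsFixedPt.iterate hy.2 n⟩

theorem eqvGen_iterate (hN : Set.MapsTo H N N) (hx : x ∈ N) (n : ℕ) :
    Relation.EqvGen (fun u v => u ∈ N ∧ v ∈ N ∧ H u = v) x (H^[n] x) := by
  induction n with
  | zero => exact .refl x
  | succ n ih =>
    have hmem := hN.iterate n hx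
    rw [iterate_succ_apply']
    exact ih.trans _ _ _ (.rel _ _ ⟨hmem, hN hmem, rfl⟩)

theorem exists_iterate_eq_of_eqvGen
    (h : Relation.EqvGen (fun u v => u ∈ N ∧ v ∈ N ∧ H u = v) x y) :
    ∃ i j, H^[i] x = H^[j] y := by
  induction h with
  | rel u v huv => exact ⟨1, 0, huv.2.2⟩
  | refl u => exact ⟨0, 0, rfl⟩
  | symm u v _ ih =>
    obtain ⟨i, j, hij⟩ := ih
    exact ⟨j, i, hij.symm⟩
  | trans u v w _ _ ihuv ihvw =>
    obtain ⟨i, j, hij⟩ := ihuv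
    obtain ⟨k, l, hkl⟩ := ihvw
    refine ⟨k + i, j + l, ?_⟩
    rw [iterate_add_apply, hij, iterate_add_apply, ← hkl, ← iterate_add_apply,
      ← iterate_add_apply, add_comm]

theorem mem_component_iff (hN : Set.MapsTo H N N) (hx : x ∈ N) :
    y ∈ component N H x ↔ y ∈ N ∧ ∃ i j, H^[i] x = H^[j] y := by
  refine and_congr_right fun hy => ⟨exists_iterate_eq_of_eqvGen, fun ⟨i, j, hij⟩ => ?_⟩
  have hxi := eqvGen_iterate hN hx i
  rw [hij] at hxi
  exact hxi.trans _ _ _ ((eqvGen_iterate hN hy j).symm _ _)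

section EventuallyFixed

variable (hN : Set.MapsTo H N N) (hev : ∀ x ∈ N, ∃ k, IsFixedPt H (H^[k] x))
include hN hev

theorem foil_eq_component (hx : x ∈ N) : foil N H x = component N H x := by
  ext y
  rw [mem_component_iff hN hx]
  refine and_congr_right fun hy => ⟨fun ⟨n, hn⟩ => ⟨n, n, hn⟩, fun ⟨i, j, hij⟩ => ?_⟩
  obtain ⟨k, hk⟩ := hev x hx
  obtain ⟨l, hl⟩ := hev y hy
  refine ⟨k + l, ?_⟩
  calc H^[k + l] x = H^[k + l + i] x :=
        (iterate_eq_of_le hk (by omega)).trans (iterate_eq_of_le hk (by omega)).symm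
    _ = H^[k + l + j] y := by rw [iterate_add_apply, hij, ← iterate_add_apply]
    _ = H^[k + l] y :=
        (iterate_eq_of_le hl (by omega)).trans (iterate_eq_of_le hl (by omega)).symm

theorem existsUnique_mem_fixedPts (hC : C ∈ components N H) :
    ∃! y, y ∈ C ∧ y ∈ fixedPts N H := by
  obtain ⟨x, hx, rfl⟩ := hC
  obtain ⟨k, hk⟩ := hev x hx
  have hkN := hN.iterate k hx
  refine ⟨H^[k] x, ⟨(mem_component_iff hN hx).2 ⟨hkN, k, 0, rfl⟩, hkN, hk⟩, ?_⟩
  rintro z ⟨hz, -, hzfix⟩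
  obtain ⟨-, i, j, hij⟩ := (mem_component_iff hN hx).1 hz
  rw [IsFixedPt.iterate hzfix j] at hij
  subst hij
  rw [← iterate_eq_of_le hzfix (le_max_right k i), iterate_eq_of_le hk (le_max_left k i)]

theorem component_infinite (hinf : ∀ y ∈ fixedPts N H, {x ∈ N | H x = y}.Infinite) (hx : x ∈ N) :
    (component N H x).Infinite := by
  obtain ⟨k, hk⟩ := hev x hx
  refine (hinf _ ⟨hN.iterate k hx, hk⟩).mono ?_
  rintro z ⟨hz, hzk⟩
  exact (mem_component_iff hN hx).2 ⟨hz, k, 1, hzk.symm⟩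

theorem typeII_of_mem_components (hinf : ∀ y ∈ fixedPts N H, {x ∈ N | H x = y}.Infinite)
    (hC : C ∈ components N H) : TypeII N H C := by
  obtain ⟨x, hx, rfl⟩ := hC
  refine ⟨component_infinite hN hev hinf hx, ?_⟩
  rintro _ ⟨z, hz, rfl⟩
  rw [foil_eq_component hN hev hz.1]
  exact component_infinite hN hev hinf hz.1

end EventuallyFixed

theorem component_eq_of_mem_fixedPts (hN : Set.MapsTo H N N) (hy : y ∈ fixedPts N H) :
    component N H y = {x ∈ N | ∃ n, H^[n] x = y} := by
  have hfix (n : ℕ) : H^[n] y = y := IsFixedPt.iterate hy.2 n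
  ext x
  simp only [mem_component_iff hN hy.1, hfix, exists_const, Set.mem_ofPred_eq, eq_comm]

theorem not_acyclic_of_mem_fixedPts (hyC : y ∈ C) (hy : y ∈ fixedPts N H) : ¬ Acyclic H C := by
  have hfix (n : ℕ) : H^[n] y = y := IsFixedPt.iterate hy.2 n
  refine fun hacyclic => hacyclic 1 {y}
    ⟨one_pos, y, minimalPeriod_eq_one_iff_isFixedPt.2 hy.2, ?_⟩ (Set.singleton_subset_iff.2 hyC)
  simp only [hfix, Set.range_const]

theorem TypeII.not_classified (h : TypeII N H C) (hcycle : ¬ Acyclic H C) :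
    ¬ Classified N H C := by
  rintro (⟨hfinite, -⟩ | ⟨-, hacyclic, -⟩ | ⟨-, hacyclic, -⟩)
  · exact h.1 hfinite
  · exact hcycle hacyclic
  · exact hcycle hacyclic

end PointShift

theorem mainTheorem6 {Ω : Type*} [MeasurableSpace Ω] (P : Measure Ω) [IsProbabilityMeasure P]
    (m : Ω → Measure AxB) (lam δ : ℝ) (hlam : 0 < lam) (hδ : 0 < δ) (hsub : 2 * δ * lam < 1)
    (hm : IsPoissonProcess P m (ENNReal.ofReal lam • AxB.haar)) :
    -- the `ax+b` group is not unimodular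
    (AxB.haar.IsHaarMeasure ∧ ¬ AxB.haar.IsMulRightInvariant) ∧
    ∀ᵐ ω ∂P, ∀ (N : Set AxB) (H : AxB → AxB),
      N = pointsOf (m ω) → H = AxB.stripShift δ N →
      -- the strip point-shift is well defined, without ties
      (∀ x ∈ N, m ω (AxB.strip δ x) < ∞ ∧ H x ∈ N ∩ AxB.strip δ x ∧
        ∀ y ∈ N ∩ AxB.strip δ x, y ≠ H x → y.a < (H x).a) ∧
      -- every orbit is eventually constant
      (∀ x ∈ N, ∃ k : ℕ, ∀ n ≥ k, H^[n] x = H^[k] x) ∧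
      -- every fixed point is the image of infinitely many points
      (∀ y ∈ PointShift.fixedPts N H, {x ∈ N | H x = y}.Infinite) ∧
      -- foils and components coincide
      (∀ x ∈ N, PointShift.foil N H x = PointShift.component N H x) ∧
      -- components correspond to fixed points
      (∀ C ∈ PointShift.components N H, ∃! y, y ∈ C ∧ y ∈ PointShift.fixedPts N H) ∧
      (∀ y ∈ PointShift.fixedPts N H,
        PointShift.component N H y = {x ∈ N | ∃ n : ℕ, H^[n] x = y}) ∧
      -- fixed points exist and are primeval
      (PointShift.fixedPts N H).Nonempty ∧
      PointShift.fixedPts N H ⊆ PointShift.primeval N H ∧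
      -- every component has type `I/I`, yet has a cycle and primeval points, so the
      -- cardinality classification fails for every component
      (∀ C ∈ PointShift.components N H,
        PointShift.TypeII N H C ∧ ¬ PointShift.Acyclic H C ∧
          (PointShift.primeval N H ∩ C).Nonempty ∧ ¬ PointShift.Classified N H C) := by
  refine ⟨⟨AxB.haar_isHaarMeasure, AxB.haar_not_isMulRightInvariant⟩, ?_⟩
  filter_upwards [AxB.ae_isGeneric_pointsOf hm hlam hδ hsub,
    AxB.ae_forall_strip_lt_top (δ := δ) hm] with ω hgen hstrip N H hNω hHN
  rw [← hNω] at hgen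
  subst hHN
  have hN := hgen.mapsTo_stripShift hδ.le
  have hev := fun x hx => hgen.exists_isFixedPt_iterate hδ.le (x := x) hx
  have hinf := fun y hy => hgen.infinite_stripShift_eq hδ.le (y := y) hy
  refine ⟨fun x hx => ⟨hstrip x, (hgen.isRightmost_stripShift hδ.le hx).1,
      fun y hy hne => hgen.lt_of_ne_stripShift hδ.le hx hy hne⟩,
    fun x hx => (hev x hx).imp fun k hk n hn => PointShift.iterate_eq_of_le hk hn,
    hinf,
    fun x hx => PointShift.foil_eq_component hN hev hx,
    fun C hC => PointShift.existsUnique_mem_fixedPts hN hev hC,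
    fun y hy => PointShift.component_eq_of_mem_fixedPts hN hy,
    ?_, PointShift.fixedPts_subset_primeval, fun C hC => ?_⟩
  · obtain ⟨x, hx⟩ := hgen.nonempty
    obtain ⟨k, hk⟩ := hev x hx
    exact ⟨_, hN.iterate k hx, hk⟩
  · obtain ⟨y, ⟨hyC, hy⟩, -⟩ := PointShift.existsUnique_mem_fixedPts hN hev hC
    have htype := PointShift.typeII_of_mem_components hN hev hinf hC
    have hcycle := PointShift.not_acyclic_of_mem_fixedPts hyC hy
    exact ⟨htype, hcycle, ⟨y, PointShift.fixedPts_subset_primeval hy, hyC⟩,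
      htype.not_classified hcycle⟩
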